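/- Let $\mathbb{F}$ be a field, let $q \in \mathbb{F}$ be nonzero and not a root of unity, and let $s, t$ be distinct integers. Let $\phi = \sum_{i} \phi_i \lambda^i \in \mathbb{F}[\lambda, \lambda^{-1}]$ be a Laurent polynomial with $\phi_s = \phi_t = 0$. Let $\mathbb{B} = \mathbb{B}_q(s,t,\phi)$ be the associative unital $\mathbb{F}$-algebra with generators $C_s, C_t, E, F, K^{\pm 1}$ and relations $$C_s, C_t \text{ are central}, \qquad K K^{-1} = K^{-1} K = 1, \qquad KE = q^2 EK, \qquad KF = q^{-2} FK,$$ $$FE = C_s q^s K^s + C_t q^t K^t + \phi(qK), \qquad EF = C_s q^{-s} K^s + C_t q^{-t} K^t + \phi(q^{-1}K).$$ Then the elements $C_s^i C_t^j$ $(i, j \in \mathbb{N} = \{0, 1, 2, \dots\})$ form a basis of the $\mathbb{F}$-vector space $Z(\mathbb{B})$, the center of $\mathbb{B}$. Moreover there exists an $\mathbb{F}$-algebra isomorphism $Z(\mathbb{B}) \to \mathbb{F}[\lambda_1, \lambda_2]$ onto the polynomial algebra in two commuting indeterminates that sends $C_s \mapsto \lambda_1$ and $C_t \mapsto \lambda_2$.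 -/

import Mathlib

open scoped LaurentPolynomial

namespace AugDownUp

/-- The generators `C_s, C_t, E, F, K, K⁻¹`. -/
inductive Gen : Type
  | Cs | Ct | E | F | K | Kinv

section

variable (𝔽 : Type*) [Field 𝔽]

/-- `𝔽[λ, λ⁻¹]_{s,t}`: the span of the monomials `λ ^ i` with `i ≠ s` and `i ≠ t`. -/
noncomputable def laurentAvoiding (s t : ℤ) : Submodule 𝔽 𝔽[T;T⁻¹] :=
  Submodule.span 𝔽 {f | ∃ i : ℤ, i ≠ s ∧ i ≠ t ∧ f = LaurentPolynomial.T i}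

/-- A generator, as an element of the free algebra. -/
noncomputable def gen (g : Gen) : FreeAlgebra 𝔽 Gen := FreeAlgebra.ι 𝔽 g

/-- The word `K ^ h` in the free algebra, for an integer `h`;
negative powers are powers of the generator `K⁻¹`. -/
noncomputable def wordK : ℤ → FreeAlgebra 𝔽 Gen
  | Int.ofNat n => gen 𝔽 Gen.K ^ n
  | Int.negSucc n => gen 𝔽 Gen.Kinv ^ (n + 1)

end

section

variable {𝔽 : Type*} [Field 𝔽]

/-- The expression `ϕ(c K) = ∑ i, ϕ_i c ^ i K ^ i` in the free algebra, for a scalar `c`. -/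
noncomputable def evalK (ϕ : 𝔽[T;T⁻¹]) (c : 𝔽) : FreeAlgebra 𝔽 Gen :=
  ϕ.coeff.sum fun i a => (a * c ^ i) • wordK 𝔽 i

/-- The defining relations of `B_q(s, t, ϕ)`. -/
inductive Rel (q : 𝔽) (s t : ℤ) (ϕ : 𝔽[T;T⁻¹]) :
    FreeAlgebra 𝔽 Gen → FreeAlgebra 𝔽 Gen → Prop
  | Cs_central (g : Gen) :
      Rel q s t ϕ (gen 𝔽 Gen.Cs * gen 𝔽 g) (gen 𝔽 g * gen 𝔽 Gen.Cs)
  | Ct_central (g : Gen) :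
      Rel q s t ϕ (gen 𝔽 Gen.Ct * gen 𝔽 g) (gen 𝔽 g * gen 𝔽 Gen.Ct)
  | K_Kinv : Rel q s t ϕ (gen 𝔽 Gen.K * gen 𝔽 Gen.Kinv) 1
  | Kinv_K : Rel q s t ϕ (gen 𝔽 Gen.Kinv * gen 𝔽 Gen.K) 1
  | K_E : Rel q s t ϕ (gen 𝔽 Gen.K * gen 𝔽 Gen.E)
      (q ^ (2 : ℤ) • (gen 𝔽 Gen.E * gen 𝔽 Gen.K))
  | K_F : Rel q s t ϕ (gen 𝔽 Gen.K * gen 𝔽 Gen.F)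
      (q ^ (-2 : ℤ) • (gen 𝔽 Gen.F * gen 𝔽 Gen.K))
  | F_E : Rel q s t ϕ (gen 𝔽 Gen.F * gen 𝔽 Gen.E)
      (q ^ s • (gen 𝔽 Gen.Cs * wordK 𝔽 s) + q ^ t • (gen 𝔽 Gen.Ct * wordK 𝔽 t) + evalK ϕ q)
  | E_F : Rel q s t ϕ (gen 𝔽 Gen.E * gen 𝔽 Gen.F)
      (q ^ (-s) • (gen 𝔽 Gen.Cs * wordK 𝔽 s) + q ^ (-t) • (gen 𝔽 Gen.Ct * wordK 𝔽 t)
        + evalK ϕ q⁻¹)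

/-- The augmented down-up algebra `B_q(s, t, ϕ)`: the associative unital `𝔽`-algebra with
generators `C_s, C_t, E, F, K, K⁻¹` subject to the relations `Rel`. -/
abbrev B (q : 𝔽) (s t : ℤ) (ϕ : 𝔽[T;T⁻¹]) : Type _ := RingQuot (Rel q s t ϕ)

/-- The image of a generator in `B_q(s, t, ϕ)`. -/
noncomputable def B.of (q : 𝔽) (s t : ℤ) (ϕ : 𝔽[T;T⁻¹]) (g : Gen) : B q s t ϕ :=
  RingQuot.mkAlgHom 𝔽 (Rel q s t ϕ) (gen 𝔽 g)

/-- An element of `B_q(s, t, ϕ)` that commutes with the generators is central. -/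
theorem B.mem_center_of_commute (q : 𝔽) (s t : ℤ) (ϕ : 𝔽[T;T⁻¹]) (x : B q s t ϕ)
    (hx : ∀ g, x * B.of q s t ϕ g = B.of q s t ϕ g * x) :
    x ∈ Subalgebra.center 𝔽 (B q s t ϕ) := by
  rw [Subalgebra.mem_center_iff]
  intro y
  obtain ⟨y, rfl⟩ := RingQuot.mkAlgHom_surjective 𝔽 (Rel q s t ϕ) y
  induction y using FreeAlgebra.induction with
  | grade0 r => rw [AlgHom.commutes]; exact Algebra.commutes r x
  | grade1 g => exact (hx g).symm
  | mul a b ha hb => rw [map_mul, mul_assoc, hb, ← mul_assoc, ha, mul_assoc]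
  | add a b ha hb => rw [map_add, add_mul, mul_add, ha, hb]

/-- The Casimir element `C_s`, as an element of the center. -/
noncomputable def casimirS (q : 𝔽) (s t : ℤ) (ϕ : 𝔽[T;T⁻¹]) :
    Subalgebra.center 𝔽 (B q s t ϕ) :=
  ⟨B.of q s t ϕ Gen.Cs, B.mem_center_of_commute q s t ϕ _ fun g => by
    simpa only [B.of, map_mul] using RingQuot.mkAlgHom_rel 𝔽 (Rel.Cs_central g)⟩

/-- The Casimir element `C_t`, as an element of the center. -/
noncomputable def casimirT (q : 𝔽) (s t : ℤ) (ϕ : 𝔽[T;T⁻¹]) :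
    Subalgebra.center 𝔽 (B q s t ϕ) :=
  ⟨B.of q s t ϕ Gen.Ct, B.mem_center_of_commute q s t ϕ _ fun g => by
    simpa only [B.of, map_mul] using RingQuot.mkAlgHom_rel 𝔽 (Rel.Ct_central g)⟩

end

end AugDownUp

/-! Let `B` act on the free module over R = 𝔽[X₀, X₁] with basis v_m (m ∈ ℤ): the Casimirs act as X₀
and X₁, K v_m = q^(2m) v_m, E v_m = v_{m+1}, and F lowers the index with coefficient `structurePoly`
at q^(2m-1). Polynomials in the Casimirs act as the corresponding scalars of R, so they are
independent (`centerMap_injective`).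

The action is faithful (`action_injective`). By `monomSpan_eq_top`, every element is a sum of
monomials p(C_s, C_t) K^h L_n with L_n a power of E or of F. Such a monomial moves v_m to a multiple
of v_{m+n}, so different n separate; for fixed n, the scalars q^(2(m+n)h) are distinct characters of
ℤ because q is not a root of unity, hence independent.

A central element commutes with K, whose eigenvalues are distinct, so it is diagonal; it commutes
with E, so its diagonal is constant. It therefore acts as some p ∈ R, and by faithfulness equals
p(C_s, C_t) (`centerMap_surjective`). -/

namespace AugDownUp

open MvPolynomial

/-! ### The weight module and the action on it -/

section Representation

variable {𝔽 : Type*} [Field 𝔽]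

/-- The polynomial `x ^ s X₀ + x ^ t X₁ + ϕ(x)`. -/
noncomputable def structurePoly (s t : ℤ) (ϕ : 𝔽[T;T⁻¹]) (x : 𝔽) : MvPolynomial (Fin 2) 𝔽 :=
  x ^ s • X 0 + x ^ t • X 1 + C (ϕ.coeff.sum fun i a => a * x ^ i)

theorem structurePoly_ne_zero (s t : ℤ) (ϕ : 𝔽[T;T⁻¹]) {x : 𝔽} (hx : x ≠ 0) :
    structurePoly s t ϕ x ≠ 0 := by
  intro h
  have := congrArg (coeff (Finsupp.single 0 1)) h
  have h0 : (0 : Fin 2 →₀ ℕ) ≠ Finsupp.single 0 1 :=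
    (Finsupp.single_ne_zero.2 one_ne_zero).symm
  simp [structurePoly, coeff_C, coeff_X, Finsupp.single_eq_single_iff, h0] at this
  exact zpow_ne_zero _ hx this

/-- The module with basis indexed by the integers on which `B_q(s, t, ϕ)` acts. -/
abbrev WeightModule (𝔽 : Type*) [Field 𝔽] : Type _ := ℤ →₀ MvPolynomial (Fin 2) 𝔽

/-- The operator sending the basis vector of index `m` to `d m` times that of index `m + k`. -/
noncomputable def weightedShift (k : ℤ) (d : ℤ → MvPolynomial (Fin 2) 𝔽) :
    Module.End (MvPolynomial (Fin 2) 𝔽) (WeightModule 𝔽) :=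
  Finsupp.linearCombination _ fun m => Finsupp.single (m + k) (d m)

theorem weightedShift_single (k : ℤ) (d : ℤ → MvPolynomial (Fin 2) 𝔽) (m : ℤ)
    (p : MvPolynomial (Fin 2) 𝔽) :
    weightedShift k d (Finsupp.single m p) = Finsupp.single (m + k) (p * d m) := by
  simp [weightedShift]

theorem end_ext {f g : Module.End (MvPolynomial (Fin 2) 𝔽) (WeightModule 𝔽)}
    (h : ∀ m, f (Finsupp.single m 1) = g (Finsupp.single m 1)) : f = g :=
  Finsupp.lhom_ext' fun m => LinearMap.ext_ring (h m)

theorem weightedShift_mul (k l : ℤ) (d e : ℤ → MvPolynomial (Fin 2) 𝔽) :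
    weightedShift k d * weightedShift l e = weightedShift (l + k) fun m => e m * d (m + l) :=
  end_ext fun m => by simp [weightedShift_single, add_assoc]

theorem weightedShift_add (k : ℤ) (d e : ℤ → MvPolynomial (Fin 2) 𝔽) :
    weightedShift k d + weightedShift k e = weightedShift k fun m => d m + e m :=
  end_ext fun m => by simp [weightedShift_single]

theorem weightedShift_smul (k : ℤ) (a : 𝔽) (d : ℤ → MvPolynomial (Fin 2) 𝔽) :
    a • weightedShift k d = weightedShift k fun m => a • d m :=
  end_ext fun m => by simp [weightedShift_single]

theorem weightedShift_zero_one :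
    weightedShift 0 (fun _ => (1 : MvPolynomial (Fin 2) 𝔽)) = 1 :=
  end_ext fun m => by simp [weightedShift_single]

theorem weightedShift_finset_sum {ι : Type*} (k : ℤ) (u : Finset ι)
    (d : ι → ℤ → MvPolynomial (Fin 2) 𝔽) :
    ∑ i ∈ u, weightedShift k (d i) = weightedShift k fun m => ∑ i ∈ u, d i m :=
  end_ext fun m => by simp [weightedShift_single, LinearMap.sum_apply, Finsupp.single_finsetSum]

variable (q : 𝔽) (s t : ℤ) (ϕ : 𝔽[T;T⁻¹])

/-- The action of the generators on the weight module. -/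
noncomputable def genAction : Gen → Module.End (MvPolynomial (Fin 2) 𝔽) (WeightModule 𝔽)
  | .Cs => weightedShift 0 fun _ => X 0
  | .Ct => weightedShift 0 fun _ => X 1
  | .E => weightedShift 1 fun _ => 1
  | .F => weightedShift (-1) fun m => structurePoly s t ϕ (q ^ (2 * m - 1))
  | .K => weightedShift 0 fun m => C (q ^ (2 * m))
  | .Kinv => weightedShift 0 fun m => C (q ^ (-(2 * m)))

/-- The action of the free algebra on the weight module. -/
noncomputable def freeAction :
    FreeAlgebra 𝔽 Gen →ₐ[𝔽] Module.End (MvPolynomial (Fin 2) 𝔽) (WeightModule 𝔽) :=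
  FreeAlgebra.lift 𝔽 (genAction q s t ϕ)

@[simp]
theorem freeAction_gen (g : Gen) : freeAction q s t ϕ (gen 𝔽 g) = genAction q s t ϕ g := by
  simp [freeAction, gen]

theorem weightedShift_zero_pow (d : ℤ → MvPolynomial (Fin 2) 𝔽) (n : ℕ) :
    weightedShift 0 d ^ n = weightedShift 0 fun m => d m ^ n := by
  induction n with
  | zero => simp [weightedShift_zero_one]
  | succ n ih => rw [pow_succ', ih, weightedShift_mul]; simp [pow_succ]

theorem freeAction_wordK (h : ℤ) :
    freeAction q s t ϕ (wordK 𝔽 h) = weightedShift 0 fun m => C ((q ^ (2 * m)) ^ h) := by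
  cases h with
  | ofNat n => simp [wordK, genAction, weightedShift_zero_pow]
  | negSucc n =>
    simp only [wordK, map_pow, freeAction_gen, genAction, weightedShift_zero_pow]
    simp only [← map_pow, zpow_negSucc, zpow_neg, inv_pow]

theorem freeAction_evalK (x : 𝔽) :
    freeAction q s t ϕ (evalK ϕ x) =
      weightedShift 0 fun m => C (ϕ.coeff.sum fun i a => a * (x * q ^ (2 * m)) ^ i) := by
  simp only [evalK, Finsupp.sum, map_sum, map_smul, freeAction_wordK, weightedShift_smul,
    weightedShift_finset_sum, mul_zpow, smul_eq_C_mul, ← map_mul, mul_assoc]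

/-- The exponent 2m - 1 in the action of F is forced here: on v_m, FE evaluates `structurePoly` at q
· q^(2m) and EF at q⁻¹ · q^(2m), matching the two last relations. -/
theorem freeAction_rel (hq0 : q ≠ 0) {x y : FreeAlgebra 𝔽 Gen} (h : Rel q s t ϕ x y) :
    freeAction q s t ϕ x = freeAction q s t ϕ y := by
  cases h with
  | Cs_central g =>
    simp only [map_mul, freeAction_gen]
    cases g <;> simp [genAction, weightedShift_mul, mul_comm]
  | Ct_central g =>
    simp only [map_mul, freeAction_gen]
    cases g <;> simp [genAction, weightedShift_mul, mul_comm]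
  | K_Kinv =>
    simp only [map_mul, freeAction_gen, genAction, weightedShift_mul]
    simp only [← C_mul, zpow_neg,
      inv_mul_cancel₀ (zpow_ne_zero _ hq0), add_zero, weightedShift_zero_one, map_one]
  | Kinv_K =>
    simp only [map_mul, freeAction_gen, genAction, weightedShift_mul]
    simp only [← C_mul, zpow_neg, mul_inv_cancel₀ (zpow_ne_zero _ hq0),
      add_zero, weightedShift_zero_one, map_one]
  | K_E =>
    simp only [map_mul, freeAction_gen, map_smul, genAction, weightedShift_mul,
      weightedShift_smul, smul_eq_C_mul, one_mul, mul_one, add_zero, zero_add]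
    simp only [← map_mul, ← zpow_add₀ hq0, mul_add, mul_one, add_comm]
  | K_F =>
    simp only [map_mul, freeAction_gen, map_smul, genAction, weightedShift_mul,
      weightedShift_smul, smul_eq_C_mul, add_zero, zero_add]
    congr! 2 with m
    rw [mul_comm, ← mul_assoc, ← map_mul, ← zpow_add₀ hq0]
    congr! 3; ring
  | F_E =>
    simp only [map_mul, freeAction_gen, map_smul, map_add, genAction, weightedShift_mul,
      weightedShift_smul, weightedShift_add, freeAction_wordK, freeAction_evalK, structurePoly]
    simp only [add_zero, add_neg_cancel, weightedShift_add]
    congr 1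
    funext m
    have : q ^ (2 * (m + 1) - 1) = q * q ^ (2 * m) := by rw [← zpow_one_add₀ hq0]; congr 1; ring
    simp only [this, mul_zpow, one_mul, smul_eq_C_mul, map_mul]
    ring
  | E_F =>
    simp only [map_mul, freeAction_gen, map_smul, map_add, genAction, weightedShift_mul,
      weightedShift_smul, weightedShift_add, freeAction_wordK, freeAction_evalK, structurePoly]
    simp only [add_zero, neg_add_cancel, weightedShift_add]
    congr 1
    funext m
    have : q ^ (2 * m - 1) = q⁻¹ * q ^ (2 * m) := by
      rw [← zpow_neg_one, ← zpow_add₀ hq0]; congr 1; ring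
    simp only [this, mul_zpow, smul_eq_C_mul, map_mul, zpow_neg, inv_zpow, mul_one]
    ring

/-- The action of `B_q(s, t, ϕ)` on the weight module. -/
noncomputable def action (hq0 : q ≠ 0) :
    B q s t ϕ →ₐ[𝔽] Module.End (MvPolynomial (Fin 2) 𝔽) (WeightModule 𝔽) :=
  RingQuot.liftAlgHom 𝔽 ⟨freeAction q s t ϕ, fun _ _ h => freeAction_rel q s t ϕ hq0 h⟩

@[simp]
theorem action_mk (hq0 : q ≠ 0) (x : FreeAlgebra 𝔽 Gen) :
    action q s t ϕ hq0 (RingQuot.mkAlgHom 𝔽 (Rel q s t ϕ) x) = freeAction q s t ϕ x := by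
  simp [action]

@[simp]
theorem action_of (hq0 : q ≠ 0) (g : Gen) :
    action q s t ϕ hq0 (B.of q s t ϕ g) = genAction q s t ϕ g := by
  simp [B.of]

/-- The map from polynomials to the center sending the variables to the Casimir elements. -/
noncomputable def centerMap :
    MvPolynomial (Fin 2) 𝔽 →ₐ[𝔽] Subalgebra.center 𝔽 (B q s t ϕ) :=
  aeval ![casimirS q s t ϕ, casimirT q s t ϕ]

theorem action_centerMap (hq0 : q ≠ 0) (p : MvPolynomial (Fin 2) 𝔽) :
    action q s t ϕ hq0 (centerMap q s t ϕ p) = weightedShift 0 fun _ => p := by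
  induction p using MvPolynomial.induction_on with
  | C a =>
    rw [← algebraMap_eq, AlgHom.commutes]
    exact ((action q s t ϕ hq0).commutes a).trans
      (end_ext fun m => by simp [weightedShift_single, algebraMap_eq, Algebra.smul_def])
  | add a b ha hb => simp only [map_add, Subalgebra.coe_add, ha, hb, weightedShift_add]
  | mul_X p i ih =>
    rw [map_mul, Subalgebra.coe_mul, map_mul, ih]
    have : action q s t ϕ hq0 (centerMap q s t ϕ (X i)) = weightedShift 0 fun _ => X i := by
      fin_cases i
      · simpa [centerMap, casimirS, genAction, -action_of] using action_of q s t ϕ hq0 .Cs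
      · simpa [centerMap, casimirT, genAction, -action_of] using action_of q s t ϕ hq0 .Ct
    rw [this, weightedShift_mul]
    simp [mul_comm]

theorem centerMap_injective (hq0 : q ≠ 0) : Function.Injective (centerMap q s t ϕ) := by
  intro p p' h
  have h1 := action_centerMap q s t ϕ hq0 p
  rw [h, action_centerMap] at h1
  have h2 := congrArg (fun f => f (Finsupp.single 0 1) 0) h1
  simpa [weightedShift_single] using h2.symm

end Representation

/-! ### Normally ordered monomials span the algebra -/

section Spanning

variable {𝔽 : Type*} [Field 𝔽] (q : 𝔽) (s t : ℤ) (ϕ : 𝔽[T;T⁻¹])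

/-- The generator `K` as a unit. -/
noncomputable def unitK : (B q s t ϕ)ˣ where
  val := B.of q s t ϕ .K
  inv := B.of q s t ϕ .Kinv
  val_inv := by simpa [B.of] using RingQuot.mkAlgHom_rel 𝔽 (Rel.K_Kinv (q := q) (s := s) (t := t) (ϕ := ϕ))
  inv_val := by simpa [B.of] using RingQuot.mkAlgHom_rel 𝔽 (Rel.Kinv_K (q := q) (s := s) (t := t) (ϕ := ϕ))

theorem mk_wordK (h : ℤ) :
    RingQuot.mkAlgHom 𝔽 (Rel q s t ϕ) (wordK 𝔽 h) = ((unitK q s t ϕ ^ h : (B q s t ϕ)ˣ) : B q s t ϕ) := by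
  cases h with
  | ofNat n => simp [wordK, unitK, B.of]
  | negSucc n => simp [wordK, unitK, B.of, zpow_negSucc, ← inv_pow]

/-- `E ^ n` for `n ≥ 0` and `F ^ (-n)` for `n < 0`. -/
noncomputable def ladder : ℤ → B q s t ϕ
  | .ofNat n => B.of q s t ϕ .E ^ n
  | .negSucc n => B.of q s t ϕ .F ^ (n + 1)

/-- The normally ordered monomial with polynomial coefficient `p`. -/
noncomputable def monom (n h : ℤ) (p : MvPolynomial (Fin 2) 𝔽) : B q s t ϕ :=
  centerMap q s t ϕ p * ((unitK q s t ϕ ^ h : (B q s t ϕ)ˣ) : B q s t ϕ) * ladder q s t ϕ n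

/-- The span of the normally ordered monomials. -/
noncomputable def monomSpan : Submodule 𝔽 (B q s t ϕ) :=
  Submodule.span 𝔽 {x | ∃ n h p, x = monom q s t ϕ n h p}

variable {q s t ϕ}

theorem monom_mem (n h : ℤ) (p : MvPolynomial (Fin 2) 𝔽) :
    monom q s t ϕ n h p ∈ monomSpan q s t ϕ :=
  Submodule.subset_span ⟨n, h, p, rfl⟩

theorem centerMap_comm (p : MvPolynomial (Fin 2) 𝔽) (x : B q s t ϕ) :
    x * centerMap q s t ϕ p = centerMap q s t ϕ p * x :=
  Subalgebra.mem_center_iff.1 (centerMap q s t ϕ p).2 x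

theorem centerMap_mul_mem (p : MvPolynomial (Fin 2) 𝔽) {x : B q s t ϕ}
    (hx : x ∈ monomSpan q s t ϕ) : centerMap q s t ϕ p * x ∈ monomSpan q s t ϕ := by
  induction hx using Submodule.span_induction with
  | mem x hx =>
    obtain ⟨n, h, p', rfl⟩ := hx
    convert monom_mem n h (p * p') using 1
    simp [monom, mul_assoc]
  | zero => simp
  | add x y _ _ hx hy => rw [mul_add]; exact add_mem hx hy
  | smul a x _ hx => rw [mul_smul_comm]; exact Submodule.smul_mem _ _ hx

theorem unitK_zpow_mul_mem (k : ℤ) {x : B q s t ϕ} (hx : x ∈ monomSpan q s t ϕ) :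
    ((unitK q s t ϕ ^ k : (B q s t ϕ)ˣ) : B q s t ϕ) * x ∈ monomSpan q s t ϕ := by
  induction hx using Submodule.span_induction with
  | mem x hx =>
    obtain ⟨n, h, p', rfl⟩ := hx
    convert monom_mem n (k + h) p' using 1
    simp only [monom, ← mul_assoc, centerMap_comm, zpow_add, Units.val_mul]
  | zero => simp
  | add x y _ _ hx hy => rw [mul_add]; exact add_mem hx hy
  | smul a x _ hx => rw [mul_smul_comm]; exact Submodule.smul_mem _ _ hx

theorem mk_evalK_mul_mem (c : 𝔽) {x : B q s t ϕ} (hx : x ∈ monomSpan q s t ϕ) :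
    RingQuot.mkAlgHom 𝔽 (Rel q s t ϕ) (evalK ϕ c) * x ∈ monomSpan q s t ϕ := by
  simp only [evalK, Finsupp.sum, map_sum, map_smul, Finset.sum_mul, mk_wordK, smul_mul_assoc]
  exact Submodule.sum_mem _ fun i _ => Submodule.smul_mem _ _ (unitK_zpow_mul_mem i hx)

theorem Cs_mul_mem {x : B q s t ϕ} (hx : x ∈ monomSpan q s t ϕ) :
    B.of q s t ϕ .Cs * x ∈ monomSpan q s t ϕ := by
  simpa [centerMap, casimirS] using centerMap_mul_mem (X 0) hx

theorem Ct_mul_mem {x : B q s t ϕ} (hx : x ∈ monomSpan q s t ϕ) :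
    B.of q s t ϕ .Ct * x ∈ monomSpan q s t ϕ := by
  simpa [centerMap, casimirT] using centerMap_mul_mem (X 1) hx

theorem ladder_mem (n : ℤ) : ladder q s t ϕ n ∈ monomSpan q s t ϕ := by
  simpa [monom] using monom_mem (q := q) (s := s) (t := t) (ϕ := ϕ) n 0 1

theorem FE_mul_mem {x : B q s t ϕ} (hx : x ∈ monomSpan q s t ϕ) :
    B.of q s t ϕ .F * B.of q s t ϕ .E * x ∈ monomSpan q s t ϕ := by
  have h := RingQuot.mkAlgHom_rel 𝔽 (Rel.F_E (q := q) (s := s) (t := t) (ϕ := ϕ))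
  simp only [map_mul, map_add, map_smul, mk_wordK] at h
  simp only [B.of, h, add_mul, smul_mul_assoc, mul_assoc]
  exact add_mem (add_mem (Submodule.smul_mem _ _ (Cs_mul_mem (unitK_zpow_mul_mem s hx)))
    (Submodule.smul_mem _ _ (Ct_mul_mem (unitK_zpow_mul_mem t hx)))) (mk_evalK_mul_mem _ hx)

theorem EF_mul_mem {x : B q s t ϕ} (hx : x ∈ monomSpan q s t ϕ) :
    B.of q s t ϕ .E * B.of q s t ϕ .F * x ∈ monomSpan q s t ϕ := by
  have h := RingQuot.mkAlgHom_rel 𝔽 (Rel.E_F (q := q) (s := s) (t := t) (ϕ := ϕ))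
  simp only [map_mul, map_add, map_smul, mk_wordK] at h
  simp only [B.of, h, add_mul, smul_mul_assoc, mul_assoc]
  exact add_mem (add_mem (Submodule.smul_mem _ _ (Cs_mul_mem (unitK_zpow_mul_mem s hx)))
    (Submodule.smul_mem _ _ (Ct_mul_mem (unitK_zpow_mul_mem t hx)))) (mk_evalK_mul_mem _ hx)

/-- E either lengthens a power of E or meets a power of F, where EF is replaced by a combination of
central multiples of powers of K. -/
theorem E_mul_ladder_mem (n : ℤ) : B.of q s t ϕ .E * ladder q s t ϕ n ∈ monomSpan q s t ϕ := by
  rcases n with n | n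
  · simpa [ladder, pow_succ'] using ladder_mem (q := q) (s := s) (t := t) (ϕ := ϕ) (.ofNat (n + 1))
  · rw [ladder, pow_succ', ← mul_assoc]
    refine EF_mul_mem ?_
    -- Cancelling E against a single F leaves 1, the rung of index 0, which lies on the nonnegative
    -- branch of `ladder`.
    rcases n with _ | n
    · simpa [ladder] using ladder_mem (q := q) (s := s) (t := t) (ϕ := ϕ) 0
    · exact ladder_mem (.negSucc n)

theorem F_mul_ladder_mem (n : ℤ) : B.of q s t ϕ .F * ladder q s t ϕ n ∈ monomSpan q s t ϕ := by
  rcases n with (_ | n) | n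
  · simpa [ladder] using ladder_mem (q := q) (s := s) (t := t) (ϕ := ϕ) (.negSucc 0)
  · rw [ladder, pow_succ', ← mul_assoc]
    exact FE_mul_mem (ladder_mem (.ofNat n))
  · simpa [ladder, pow_succ'] using ladder_mem (q := q) (s := s) (t := t) (ϕ := ϕ) (.negSucc (n + 1))

/-- If a unit `u` satisfies `u x = a x u` then `x u ^ h = a ^ (-h) u ^ h x`. -/
theorem mul_units_zpow_of_qcomm {A : Type*} [Ring A] [Algebra 𝔽 A] (u : Aˣ) (x : A) {a : 𝔽}
    (ha : a ≠ 0) (h : (u : A) * x = a • (x * u)) (k : ℤ) :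
    x * ((u ^ k : Aˣ) : A) = a ^ (-k) • (((u ^ k : Aˣ) : A) * x) := by
  have h1 : x * (u : A) = a⁻¹ • ((u : A) * x) := by rw [h, inv_smul_smul₀ ha]
  have h2 : x * ((u⁻¹ : Aˣ) : A) = a • (((u⁻¹ : Aˣ) : A) * x) := by
    rw [Units.mul_inv_eq_iff_eq_mul, smul_mul_assoc, mul_assoc, ← mul_smul_comm, ← h,
      Units.inv_mul_cancel_left]
  induction k using Int.induction_on with
  | zero => simp
  | succ n ih =>
    rw [zpow_add_one, Units.val_mul, ← mul_assoc, ih, smul_mul_assoc, mul_assoc, h1,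
      mul_smul_comm, smul_smul, mul_assoc, neg_add, zpow_add₀ ha, zpow_neg_one]
  | pred n ih =>
    rw [zpow_sub_one, Units.val_mul, ← mul_assoc, ih, smul_mul_assoc, mul_assoc, h2,
      mul_smul_comm, smul_smul, mul_assoc, neg_sub, sub_eq_add_neg, neg_neg, zpow_add₀ ha,
      zpow_one, mul_comm (a ^ _)]

/-- Such an x passes the central coefficient freely and K^k at the cost of a scalar, so only its
product with the ladder matters. -/
theorem mul_mem_of_qcomm {x : B q s t ϕ} {a : 𝔽} (ha : a ≠ 0)
    (h : (unitK q s t ϕ : B q s t ϕ) * x = a • (x * unitK q s t ϕ))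
    (hx : ∀ n, x * ladder q s t ϕ n ∈ monomSpan q s t ϕ) {y : B q s t ϕ}
    (hy : y ∈ monomSpan q s t ϕ) : x * y ∈ monomSpan q s t ϕ := by
  induction hy using Submodule.span_induction with
  | mem y hy =>
    obtain ⟨n, k, p, rfl⟩ := hy
    rw [monom, ← mul_assoc, ← mul_assoc, centerMap_comm, mul_assoc _ x,
      mul_units_zpow_of_qcomm _ x ha h, mul_smul_comm, smul_mul_assoc, mul_assoc, mul_assoc]
    exact Submodule.smul_mem _ _ (centerMap_mul_mem _ (unitK_zpow_mul_mem _ (hx n)))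
  | zero => simp
  | add x y _ _ hx hy => rw [mul_add]; exact add_mem hx hy
  | smul a x _ hx => rw [mul_smul_comm]; exact Submodule.smul_mem _ _ hx

theorem of_mul_mem (hq0 : q ≠ 0) (g : Gen) {y : B q s t ϕ}
    (hy : y ∈ monomSpan q s t ϕ) : B.of q s t ϕ g * y ∈ monomSpan q s t ϕ := by
  cases g with
  | Cs => exact Cs_mul_mem hy
  | Ct => exact Ct_mul_mem hy
  | E =>
    refine mul_mem_of_qcomm (zpow_ne_zero 2 hq0) ?_ E_mul_ladder_mem hy
    have h := RingQuot.mkAlgHom_rel 𝔽 (Rel.K_E (q := q) (s := s) (t := t) (ϕ := ϕ))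
    rw [map_mul, map_smul, map_mul] at h
    exact h
  | F =>
    refine mul_mem_of_qcomm (zpow_ne_zero (-2) hq0) ?_ F_mul_ladder_mem hy
    have h := RingQuot.mkAlgHom_rel 𝔽 (Rel.K_F (q := q) (s := s) (t := t) (ϕ := ϕ))
    rw [map_mul, map_smul, map_mul] at h
    exact h
  | K => simpa [unitK] using unitK_zpow_mul_mem 1 hy
  | Kinv => simpa [unitK] using unitK_zpow_mul_mem (-1) hy

/-- The span is a left ideal containing 1. -/
theorem monomSpan_eq_top (hq0 : q ≠ 0) : monomSpan q s t ϕ = ⊤ := by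
  suffices h : ∀ x : FreeAlgebra 𝔽 Gen, ∀ y ∈ monomSpan q s t ϕ,
      RingQuot.mkAlgHom 𝔽 (Rel q s t ϕ) x * y ∈ monomSpan q s t ϕ by
    refine eq_top_iff.2 fun x _ => ?_
    obtain ⟨x, rfl⟩ := RingQuot.mkAlgHom_surjective 𝔽 (Rel q s t ϕ) x
    simpa [ladder] using h x _ (ladder_mem 0)
  intro x
  induction x using FreeAlgebra.induction with
  | grade0 r =>
    intro y hy
    rw [AlgHom.commutes, ← Algebra.smul_def]
    exact Submodule.smul_mem _ _ hy
  | grade1 g => exact fun y hy => of_mul_mem hq0 g hy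
  | mul a b ha hb => intro y hy; rw [map_mul, mul_assoc]; exact ha _ (hb _ hy)
  | add a b ha hb => intro y hy; rw [map_add, add_mul]; exact add_mem (ha _ hy) (hb _ hy)

end Spanning

/-! ### Faithfulness of the action and the center -/

section Center

variable {𝔽 : Type*} [Field 𝔽] {q : 𝔽} {s t : ℤ} {ϕ : 𝔽[T;T⁻¹]}

theorem zpow_injective_of_pow_ne_one (hq0 : q ≠ 0) (hq : ∀ n : ℕ, 0 < n → q ^ n ≠ 1) :
    Function.Injective fun n : ℤ => q ^ n := by
  have key : ∀ n : ℤ, q ^ n = 1 → n = 0 := by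
    intro n hn
    by_contra h0
    refine hq n.natAbs (Int.natAbs_pos.2 h0) ?_
    rcases Int.natAbs_eq n with h | h
    · rw [h, zpow_natCast] at hn; exact hn
    · rw [h, zpow_neg, zpow_natCast, inv_eq_one] at hn; exact hn
  intro m n h
  refine sub_eq_zero.1 (key _ ?_)
  rw [zpow_sub₀ hq0, div_eq_one_iff_eq (zpow_ne_zero _ hq0)]
  exact h

/-- A Laurent polynomial over `𝔽[X₀, X₁]` vanishing at all `q ^ (2 m)` is zero. -/
theorem eq_zero_of_sum_zpow_eq_zero (hq0 : q ≠ 0) (hq : ∀ n : ℕ, 0 < n → q ^ n ≠ 1)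
    (r : ℤ →₀ MvPolynomial (Fin 2) 𝔽)
    (hr : ∀ m : ℤ, (r.sum fun h p => p * C ((q ^ (2 * m)) ^ h)) = 0) : r = 0 := by
  -- The character m ↦ q^(2hm) of ℤ; distinct h give distinct characters, so Dedekind's independence
  -- applies over the domain R.
  let χ : ℤ → Multiplicative ℤ →* MvPolynomial (Fin 2) 𝔽 := fun h =>
    (C : 𝔽 →+* MvPolynomial (Fin 2) 𝔽).toMonoidHom.comp
      ((Units.coeHom 𝔽).comp (zpowersHom 𝔽ˣ (Units.mk0 q hq0 ^ (2 * h))))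
  have hχ : ∀ h m : ℤ, χ h (Multiplicative.ofAdd m) = C ((q ^ (2 * m)) ^ h) := by
    intro h m
    simp only [χ, MonoidHom.comp_apply, zpowersHom_apply, toAdd_ofAdd, Units.coeHom_apply,
      Units.val_zpow_eq_zpow_val, Units.val_mk0, ← zpow_mul]
    change C _ = _
    congr 2; ring
  have hinj : Function.Injective χ := by
    intro h h' e
    have e1 := DFunLike.congr_fun e (Multiplicative.ofAdd 1)
    rw [hχ, hχ] at e1
    have e2 := C_injective _ _ e1
    rw [← zpow_mul, ← zpow_mul] at e2
    have := zpow_injective_of_pow_ne_one hq0 hq e2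
    omega
  have hli := (linearIndependent_monoidHom (Multiplicative ℤ)
    (MvPolynomial (Fin 2) 𝔽)).comp χ hinj
  refine linearIndependent_iff.1 hli r ?_
  ext1 m
  have := hr m.toAdd
  rw [Finsupp.linearCombination_apply, Finsupp.sum, Finset.sum_apply]
  simp only [← hχ] at this
  exact this

theorem exists_action_ladder (hq0 : q ≠ 0) (n m : ℤ) :
    ∃ g : MvPolynomial (Fin 2) 𝔽, g ≠ 0 ∧
      action q s t ϕ hq0 (ladder q s t ϕ n) (Finsupp.single m 1) = Finsupp.single (m + n) g := by
  rcases n with n | n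
  · refine ⟨1, one_ne_zero, ?_⟩
    simp only [ladder, map_pow, action_of, genAction]
    induction n with
    | zero => simp
    | succ n ih =>
      rw [pow_succ', Module.End.mul_apply, ih, weightedShift_single]
      simp [add_assoc]
  · simp only [ladder, map_pow, action_of, genAction]
    induction n with
    | zero =>
      exact ⟨_, structurePoly_ne_zero s t ϕ (zpow_ne_zero _ hq0), by
        rw [zero_add, pow_one, weightedShift_single, one_mul]; rfl⟩
    | succ n ih =>
      obtain ⟨g, hg, h⟩ := ih
      refine ⟨_, mul_ne_zero hg (structurePoly_ne_zero s t ϕ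
        (zpow_ne_zero (2 * (m + Int.negSucc n) - 1) hq0)), ?_⟩
      rw [pow_succ', Module.End.mul_apply, h, weightedShift_single]
      congr 1
      omega

theorem action_monom (hq0 : q ≠ 0) (n h m : ℤ) (p g : MvPolynomial (Fin 2) 𝔽)
    (hg : action q s t ϕ hq0 (ladder q s t ϕ n) (Finsupp.single m 1) = Finsupp.single (m + n) g) :
    action q s t ϕ hq0 (monom q s t ϕ n h p) (Finsupp.single m 1) =
      Finsupp.single (m + n) (p * C ((q ^ (2 * (m + n))) ^ h) * g) := by
  rw [monom, map_mul, map_mul, Module.End.mul_apply, Module.End.mul_apply, hg, ← mk_wordK,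
    action_mk, freeAction_wordK, action_centerMap, weightedShift_single, weightedShift_single,
    add_zero, add_zero]
  congr 1; ring

/-- The monomials, assembled into a linear map. -/
noncomputable def monomMap (q : 𝔽) (s t : ℤ) (ϕ : 𝔽[T;T⁻¹]) :
    (ℤ →₀ ℤ →₀ MvPolynomial (Fin 2) 𝔽) →ₗ[𝔽] B q s t ϕ :=
  Finsupp.lsum 𝔽 fun n => Finsupp.lsum 𝔽 fun h =>
    LinearMap.mulRight 𝔽 (ladder q s t ϕ n) ∘ₗ
      LinearMap.mulRight 𝔽 ((unitK q s t ϕ ^ h : (B q s t ϕ)ˣ) : B q s t ϕ) ∘ₗ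
        (Subalgebra.val _).toLinearMap ∘ₗ (centerMap q s t ϕ).toLinearMap

theorem monomMap_apply (f : ℤ →₀ ℤ →₀ MvPolynomial (Fin 2) 𝔽) :
    monomMap q s t ϕ f = f.sum fun n r => r.sum fun h p => monom q s t ϕ n h p := by
  simp [monomMap, monom, Finsupp.sum]

theorem monomMap_surjective (hq0 : q ≠ 0) : Function.Surjective (monomMap q s t ϕ) := by
  rw [← LinearMap.range_eq_top, eq_top_iff, ← monomSpan_eq_top hq0, monomSpan, Submodule.span_le]
  rintro _ ⟨n, h, p, rfl⟩
  refine ⟨Finsupp.single n (Finsupp.single h p), ?_⟩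
  rw [monomMap_apply, Finsupp.sum_single_index (by simp), Finsupp.sum_single_index (by simp [monom])]

theorem action_injective (hq0 : q ≠ 0) (hq : ∀ n : ℕ, 0 < n → q ^ n ≠ 1) :
    Function.Injective (action q s t ϕ hq0) := by
  rw [injective_iff_map_eq_zero]
  intro z hz
  obtain ⟨f, rfl⟩ := monomMap_surjective hq0 z
  suffices f = 0 by rw [this, map_zero]
  choose g hg0 hg using exists_action_ladder (s := s) (t := t) (ϕ := ϕ) hq0
  ext1 n
  refine eq_zero_of_sum_zpow_eq_zero hq0 hq _ fun k => ?_
  obtain ⟨m, rfl⟩ : ∃ m, k = m + n := ⟨k - n, by ring⟩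
  -- The v_{m+n}-coordinate of the image of v_m sees only the component of ladder index n; the
  -- nonzero factor `g n m` is then cancelled.
  have h := congrArg (fun a => a (Finsupp.single m 1) (m + n)) hz
  simp only [monomMap_apply, Finsupp.sum, map_sum, LinearMap.sum_apply,
    action_monom hq0 _ _ m _ _ (hg _ m), Finsupp.finsetSum_apply, LinearMap.zero_apply,
    Finsupp.zero_apply] at h
  rw [Finset.sum_eq_single n] at h
  · simp only [Finsupp.single_eq_same, ← Finset.sum_mul] at h
    exact (mul_eq_zero.1 h).resolve_right (hg0 n m)
  · intro n' _ hn
    exact Finset.sum_eq_zero fun h _ => Finsupp.single_eq_of_ne (by omega)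
  · intro hn
    simp [Finsupp.notMem_support_iff.1 hn]

theorem centerMap_surjective (hq0 : q ≠ 0) (hq : ∀ n : ℕ, 0 < n → q ^ n ≠ 1) :
    Function.Surjective (centerMap q s t ϕ) := by
  rintro ⟨z, hz⟩
  rw [Subalgebra.mem_center_iff] at hz
  set ρ := action q s t ϕ hq0 with hρ
  let a : ℤ → ℤ → MvPolynomial (Fin 2) 𝔽 := fun m k => ρ z (Finsupp.single m 1) k
  have hcomm : ∀ g v, genAction q s t ϕ g (ρ z v) = ρ z (genAction q s t ϕ g v) := by
    intro g v
    have := congrArg (fun x => ρ x v) (hz (B.of q s t ϕ g))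
    simpa only [map_mul, hρ, action_of, Module.End.mul_apply] using this
  have hshift : ∀ (d : ℤ → MvPolynomial (Fin 2) 𝔽) (j k : ℤ) (v : WeightModule 𝔽),
      weightedShift j d v (k + j) = v k * d k := by
    intro d j k v
    induction v using Finsupp.induction_linear with
    | zero => simp
    | add v w hv hw => rw [map_add (weightedShift j d), Finsupp.add_apply, hv, hw, Finsupp.add_apply, add_mul]
    | single m p =>
      rw [weightedShift_single]
      by_cases hm : m = k
      · simp [hm]
      · rw [Finsupp.single_eq_of_ne (by omega), Finsupp.single_eq_of_ne (Ne.symm hm), zero_mul]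
  -- ρ z is R-linear, so its matrix a determines it.
  have hsingle : ∀ m p k, ρ z (Finsupp.single m p) k = p * a m k := by
    intro m p k
    rw [← mul_one p, ← smul_eq_mul, ← Finsupp.smul_single, map_smul, Finsupp.smul_apply]
    simp [a]
  -- Commuting with K gives (q^(2k) - q^(2m)) a m k = 0.
  have hdiag : ∀ m k, k ≠ m → a m k = 0 := by
    intro m k hk
    have h := DFunLike.congr_fun (hcomm .K (Finsupp.single m 1)) k
    have h1 := hshift (fun m => C (q ^ (2 * m))) 0 k (ρ z (Finsupp.single m 1))
    rw [add_zero] at h1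
    simp only [genAction] at h
    rw [h1, weightedShift_single, add_zero, one_mul, hsingle m (C _), mul_comm, ← sub_eq_zero,
      ← sub_mul, ← map_sub] at h
    refine (mul_eq_zero.1 h).resolve_left fun h0 => hk ?_
    rw [map_eq_zero_iff _ (C_injective _ _), sub_eq_zero] at h0
    have := zpow_injective_of_pow_ne_one hq0 hq h0
    omega
  have hstep : ∀ m, a (m + 1) (m + 1) = a m m := by
    intro m
    have h := DFunLike.congr_fun (hcomm .E (Finsupp.single m 1)) (m + 1)
    simp only [genAction] at h
    rw [hshift, weightedShift_single, hsingle] at h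
    simpa using h.symm
  have hconst : ∀ m, a m m = a 0 0 := by
    intro m
    induction m using Int.induction_on with
    | zero => rfl
    | succ n ih => rw [hstep, ih]
    | pred n ih => rw [← ih, ← hstep, sub_add_cancel]
  refine ⟨a 0 0, Subtype.ext (action_injective hq0 hq ?_)⟩
  rw [action_centerMap]
  refine end_ext fun m => ?_
  ext1 k
  rw [weightedShift_single, add_zero, one_mul]
  change _ = a m k
  by_cases hk : k = m
  · rw [hk, Finsupp.single_eq_same, hconst m]
  · rw [Finsupp.single_eq_of_ne hk, hdiag m k hk]

/-- The center of `B_q(s, t, ϕ)` is the polynomial algebra in the Casimir elements. -/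
noncomputable def centerEquiv (hq0 : q ≠ 0) (hq : ∀ n : ℕ, 0 < n → q ^ n ≠ 1) (s t : ℤ)
    (ϕ : 𝔽[T;T⁻¹]) :
    MvPolynomial (Fin 2) 𝔽 ≃ₐ[𝔽] Subalgebra.center 𝔽 (B q s t ϕ) :=
  AlgEquiv.ofBijective (centerMap q s t ϕ)
    ⟨centerMap_injective q s t ϕ hq0, centerMap_surjective hq0 hq⟩

theorem centerEquiv_apply (hq0 : q ≠ 0) (hq : ∀ n : ℕ, 0 < n → q ^ n ≠ 1)
    (p : MvPolynomial (Fin 2) 𝔽) :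
    centerEquiv hq0 hq s t ϕ p = aeval ![casimirS q s t ϕ, casimirT q s t ϕ] p := rfl

end Center

end AugDownUp

theorem theorem4p1 {𝔽 : Type*} [Field 𝔽] (q : 𝔽) (hq0 : q ≠ 0)
    (hq : ∀ n : ℕ, 0 < n → q ^ n ≠ 1) (s t : ℤ) (hst : s ≠ t)
    (ϕ : LaurentPolynomial 𝔽) (hϕ : ϕ ∈ AugDownUp.laurentAvoiding 𝔽 s t) :
    (∃ b : Module.Basis (ℕ × ℕ) 𝔽 (Subalgebra.center 𝔽 (AugDownUp.B q s t ϕ)),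
      ∀ i j : ℕ, b (i, j) =
        AugDownUp.casimirS q s t ϕ ^ i * AugDownUp.casimirT q s t ϕ ^ j) ∧
    (∃ e : Subalgebra.center 𝔽 (AugDownUp.B q s t ϕ) ≃ₐ[𝔽] MvPolynomial (Fin 2) 𝔽,
      e (AugDownUp.casimirS q s t ϕ) = MvPolynomial.X 0 ∧
      e (AugDownUp.casimirT q s t ϕ) = MvPolynomial.X 1) := by
  refine ⟨⟨((MvPolynomial.basisMonomials (Fin 2) 𝔽).reindex
      (Finsupp.equivFunOnFinite.trans (finTwoArrowEquiv ℕ))).map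
      (AugDownUp.centerEquiv hq0 hq s t ϕ).toLinearEquiv, fun i j => ?_⟩,
    (AugDownUp.centerEquiv hq0 hq s t ϕ).symm, ?_, ?_⟩
  · simp [AugDownUp.centerEquiv_apply, MvPolynomial.aeval_monomial, Finsupp.prod_fintype]
  · rw [AlgEquiv.symm_apply_eq]; simp [AugDownUp.centerEquiv_apply]
  · rw [AlgEquiv.symm_apply_eq]; simp [AugDownUp.centerEquiv_apply]
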